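/- Fix integers $U\ge 1$ (users), $1\le L\le W$ (channel taps, subcarriers), and $\delta\in\mathbb R$ with $\delta^2\le 1$. For each number $B$ of base-station antennas let $\sigma=\sigma_B\ge 0$ and consider the frequency-domain channel matrices $$\mathbf H_\omega=\sum_{\ell=0}^{L-1}\mathbf R^{1/2}\,\mathbf H^{\mathrm u}_\ell\,e^{-j2\pi\omega\ell/W}+\sigma_B\mathbf E_\omega\in\mathbb C^{B\times U},\qquad \omega=0,\dots,W-1,$$ where the entries of all $\mathbf H^{\mathrm u}_\ell$ and $\mathbf E_\omega$ are mutually independent circularly-symmetric complex Gaussians, those of $\mathbf H^{\mathrm u}_\ell$ with law $\mathcal{CN}(0,1/(BL))$ and those of $\mathbf E_\omega$ with law $\mathcal{CN}(0,1)$, and where $\mathbf R^{1/2}=\alpha\mathbf I_B+\beta\mathbf 1_B$, with $\alpha=\sqrt{1-\delta}$ and $\beta=\frac1B\bigl(\sqrt{1+(B-1)\delta}-\alpha\bigr)$, is the principal square root of the correlation matrix $\mathbf R=(1-\delta)\mathbf I_B+\delta\mathbf 1_B$ ($\mathbf 1_B$ the all-ones matrix; the square root of a negative number is its principal complex root). Let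 $\mathbf G_\omega=\mathbf H_\omega^H\mathbf H_\omega$. Let $\mathcal P\subset\Omega\subset\{0,\dots,W-1\}$ be the base points and the active subcarriers; for each $\omega\in\Omega$ let $p\in\mathcal P$ be a base point nearest to $\omega$, put $\widetilde{\mathbf G}_\omega=\mathbf G_p$, and let $$0\textsf{-MSE}^{(m,n)}_\omega=\mathbb E\bigl[\,|[\widetilde{\mathbf G}_\omega]_{m,n}-[\mathbf G_\omega]_{m,n}|^2\,\bigr].$$ Assume that $\varepsilon_{\mathrm{CSI}}=2\sigma_B^2(2+B\sigma_B^2)\to 0$ as $B\to\infty$. Then these expectations are finite, and for every $\omega\in\Omega$ and every entry $(m,n)$ $$\lim_{B\to\infty}0\textsf{-MSE}^{(m,n)}_\omega=2\delta^2\Bigl(1-f_L\bigl(\tfrac{2\pi}{W}(p-\omega)\bigr)\Bigr),\qquad f_L(\phi)=L^{-2}\,\frac{1-\cos(L\phi)}{1-\cos\phi}\quad(f_L(\phi)=1\text{ for }\phi\in2\pi\mathbb Z).$$ Consequently, if $L\ge 2$, then for every $\omega\in\Omega\setminus\mathcal P$ and every entry $(m,n)$ the MSE vanishes as $B\to\infty$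 if and only if the antennas are uncorrelated, i.e. $\delta=0$; and, if $\Omega\setminus\mathcal P\ne\emptyset$, the MSE vanishes in this limit across all active subcarriers and entries if and only if $\delta=0$. -/

import Mathlib

open MeasureTheory ProbabilityTheory Filter Topology
open scoped NNReal ComplexOrder

noncomputable section

/-- The circularly-symmetric complex Gaussian law `CN(0, v)`: real and imaginary parts are
independent real Gaussians, each of mean `0` and variance `v / 2`. -/
def complexGaussian (v : ℝ≥0) : Measure ℂ :=
  ((gaussianReal 0 (v / 2)).prod (gaussianReal 0 (v / 2))).map
    (fun q : ℝ × ℝ => (q.1 : ℂ) + (q.2 : ℂ) * Complex.I)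

/-- The `B × B` receive correlation matrix `R = (1 - δ) I + δ 𝟏` (`𝟏` the all-ones matrix):
ones on the diagonal, `δ` off the diagonal. -/
def corrMatrix (B : ℕ) (δ : ℝ) : Matrix (Fin B) (Fin B) ℂ :=
  ((1 - δ : ℝ) : ℂ) • (1 : Matrix (Fin B) (Fin B) ℂ) + (δ : ℂ) • Matrix.of (fun _ _ => (1 : ℂ))

/-- The principal square root `R^{1/2} = α I + β 𝟏` of the correlation matrix, with
`α = √(1 - δ)` and `β = (√(1 + (B - 1) δ) - α) / B`. The roots are principal complex square
roots, so that `R^{1/2}` also makes sense if `1 + (B - 1) δ < 0`. See `corrSqrt_mul_self` and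
`corrSqrt_posSemidef`. -/
def corrSqrt (B : ℕ) (δ : ℝ) : Matrix (Fin B) (Fin B) ℂ :=
  (((1 - δ : ℝ) : ℂ) ^ (2⁻¹ : ℂ)) • (1 : Matrix (Fin B) (Fin B) ℂ) +
    (((((1 + ((B : ℝ) - 1) * δ : ℝ) : ℂ) ^ (2⁻¹ : ℂ)) - ((1 - δ : ℝ) : ℂ) ^ (2⁻¹ : ℂ)) / (B : ℂ)) •
      Matrix.of (fun _ _ => (1 : ℂ))

/-- `R^{1/2}` squares to `R`. -/
theorem corrSqrt_mul_self (B : ℕ) (δ : ℝ) : corrSqrt B δ * corrSqrt B δ = corrMatrix B δ := by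
  rcases Nat.eq_zero_or_pos B with rfl | hB
  · exact Subsingleton.elim _ _
  have hB' : (B : ℂ) ≠ 0 := by exact_mod_cast hB.ne'
  have hsq : ∀ z : ℂ, (z ^ (2⁻¹ : ℂ)) ^ 2 = z := fun z => by
    simp
  have h1 := hsq ((1 - δ : ℝ) : ℂ)
  have h2 := hsq ((1 + ((B : ℝ) - 1) * δ : ℝ) : ℂ)
  have hJ : (Matrix.of (fun _ _ => (1 : ℂ)) : Matrix (Fin B) (Fin B) ℂ) *
      Matrix.of (fun _ _ => (1 : ℂ)) = (B : ℂ) • Matrix.of (fun _ _ => (1 : ℂ)) := by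
    ext i j
    simp [Matrix.mul_apply]
  unfold corrSqrt corrMatrix
  set a := ((1 - δ : ℝ) : ℂ) ^ (2⁻¹ : ℂ)
  set c := ((1 + ((B : ℝ) - 1) * δ : ℝ) : ℂ) ^ (2⁻¹ : ℂ)
  set J : Matrix (Fin B) (Fin B) ℂ := Matrix.of (fun _ _ => (1 : ℂ))
  have hδ : (δ : ℂ) = 2 * a * ((c - a) / B) + ((c - a) / B) ^ 2 * B := by
    field_simp
    push_cast at h1 h2
    linear_combination h1 - h2
  rw [← h1, hδ]
  simp only [add_mul, mul_add, smul_mul_assoc, mul_smul_comm, one_mul, mul_one, hJ, smul_smul]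
  module

/-- If `R` is positive semidefinite then so is `R^{1/2}`; together with `corrSqrt_mul_self` this
says that `R^{1/2}` is then the usual positive semidefinite square root. -/
theorem corrSqrt_posSemidef (B : ℕ) (δ : ℝ) (hδ : δ ^ 2 ≤ 1) (hR : (corrMatrix B δ).PosSemidef) :
    (corrSqrt B δ).PosSemidef := by
  rcases Nat.eq_zero_or_pos B with rfl | hB
  · rw [Subsingleton.elim (corrSqrt 0 δ) 0]
    exact Matrix.PosSemidef.zero
  have hB' : (B : ℂ) ≠ 0 := by exact_mod_cast hB.ne'
  have hBr : (0 : ℝ) < B := by exact_mod_cast hB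
  have h1 : 0 ≤ 1 - δ := by nlinarith
  have h2 : 0 ≤ 1 + ((B : ℝ) - 1) * δ := by
    have h := hR.dotProduct_mulVec_nonneg (fun _ => (1 : ℂ))
    have e : star (fun _ : Fin B => (1 : ℂ)) ⬝ᵥ (corrMatrix B δ).mulVec (fun _ => (1 : ℂ)) =
        ((B * (1 + ((B : ℝ) - 1) * δ) : ℝ) : ℂ) := by
      simp [corrMatrix, dotProduct, Matrix.mulVec, Matrix.one_apply, Finset.sum_add_distrib]
      ring
    rw [e] at h
    have h' : (0 : ℝ) ≤ B * (1 + ((B : ℝ) - 1) * δ) := by exact_mod_cast h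
    exact nonneg_of_mul_nonneg_right h' hBr
  have hc : ∀ r : ℝ, 0 ≤ r → 0 ≤ (r : ℂ) ^ (2⁻¹ : ℂ) := fun r hr => by
    have : (r : ℂ) ^ (2⁻¹ : ℂ) = ((r ^ (2⁻¹ : ℝ) : ℝ) : ℂ) := by
      rw [Complex.ofReal_cpow hr]; norm_num
    rw [this]
    exact_mod_cast Real.rpow_nonneg hr _
  have ha := hc _ h1
  have hg := hc _ h2
  unfold corrSqrt
  set a := ((1 - δ : ℝ) : ℂ) ^ (2⁻¹ : ℂ)
  set c := ((1 + ((B : ℝ) - 1) * δ : ℝ) : ℂ) ^ (2⁻¹ : ℂ)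
  set J : Matrix (Fin B) (Fin B) ℂ := Matrix.of (fun _ _ => (1 : ℂ)) with hJdef
  have hJ : J * J = (B : ℂ) • J := by
    ext i j
    simp [hJdef, Matrix.mul_apply]
  have hJH : J.conjTranspose = J := by
    ext i j
    simp [hJdef]
  have hQ : ((1 : Matrix (Fin B) (Fin B) ℂ) - (B : ℂ)⁻¹ • J).PosSemidef := by
    have h := Matrix.posSemidef_conjTranspose_mul_self
      ((1 : Matrix (Fin B) (Fin B) ℂ) - (B : ℂ)⁻¹ • J)
    convert h using 1
    simp only [Matrix.conjTranspose_sub, Matrix.conjTranspose_one, Matrix.conjTranspose_smul, hJH,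
      sub_mul, mul_sub, smul_mul_assoc, mul_smul_comm, one_mul, mul_one, hJ, smul_smul]
    simp [hB']
  have hP : ((B : ℂ)⁻¹ • J).PosSemidef := by
    have h := Matrix.posSemidef_conjTranspose_mul_self ((B : ℂ)⁻¹ • J)
    convert h using 1
    simp only [Matrix.conjTranspose_smul, hJH, smul_mul_assoc, mul_smul_comm, hJ, smul_smul]
    simp [hB']
  have e : a • (1 : Matrix (Fin B) (Fin B) ℂ) + ((c - a) / B) • J =
      a • (1 - (B : ℂ)⁻¹ • J) + c • ((B : ℂ)⁻¹ • J) := by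
    rw [div_eq_mul_inv]
    module
  rw [e]
  exact (hQ.smul ha).add (hP.smul hg)

/-- The statistical model for `B` antennas, `U` users, `W` subcarriers, `L` channel taps:
`h ℓ b u` are the entries of the uncorrelated time-domain matrices (`ℓ = 0, …, L - 1`), each
`CN(0, 1/(BL))`; `e w b u` are the entries of the channel-estimation error matrices, each
`CN(0, 1)`; all of these random variables are mutually independent. -/
structure IsChannelModel {B U W L : ℕ} {Ω : Type*} [MeasurableSpace Ω] (P : Measure Ω)
    (h : Fin L → Fin B → Fin U → Ω → ℂ) (e : Fin W → Fin B → Fin U → Ω → ℂ) : Prop where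
  law_h : ∀ ℓ b u, HasLaw (h ℓ b u) (complexGaussian (1 / ((B : ℝ≥0) * (L : ℝ≥0)))) P
  law_e : ∀ w b u, HasLaw (e w b u) (complexGaussian 1) P
  indep : iIndepFun
    (Sum.elim (fun i : Fin L × Fin B × Fin U => h i.1 i.2.1 i.2.2)
      (fun i : Fin W × Fin B × Fin U => e i.1 i.2.1 i.2.2)) P

/-- The correlated time-domain channel matrix `H_ℓ = R^{1/2} H_ℓ^{uncorrelated}`. -/
def timeChannel {B U L : ℕ} {Ω : Type*} (δ : ℝ) (h : Fin L → Fin B → Fin U → Ω → ℂ)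
    (ℓ : Fin L) (x : Ω) : Matrix (Fin B) (Fin U) ℂ :=
  corrSqrt B δ * Matrix.of (fun b u => h ℓ b u x)

/-- The frequency-domain channel matrix
`H_w = ∑_{ℓ < L} H_ℓ exp(-j 2π w ℓ / W) + σ E_w` on subcarrier `w`. -/
def freqChannel {B U W L : ℕ} {Ω : Type*} (δ σ : ℝ) (h : Fin L → Fin B → Fin U → Ω → ℂ)
    (e : Fin W → Fin B → Fin U → Ω → ℂ) (w : Fin W) (x : Ω) : Matrix (Fin B) (Fin U) ℂ :=
  (∑ ℓ : Fin L, Complex.exp (-(Complex.I * 2 * (Real.pi : ℂ) * ((w : ℕ) : ℂ) * ((ℓ : ℕ) : ℂ)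
      / (W : ℂ))) • timeChannel δ h ℓ x) +
    (σ : ℂ) • Matrix.of (fun b u => e w b u x)

/-- The Gram matrix `G_w = H_w^H H_w` on subcarrier `w`. -/
def gram {B U W L : ℕ} {Ω : Type*} (δ σ : ℝ) (h : Fin L → Fin B → Fin U → Ω → ℂ)
    (e : Fin W → Fin B → Fin U → Ω → ℂ) (w : Fin W) (x : Ω) : Matrix (Fin U) (Fin U) ℂ :=
  (freqChannel δ σ h e w x).conjTranspose * freqChannel δ σ h e w x

/-- `p` is a base point (an element of `S`) closest to the subcarrier `w`. -/
def IsNearestBasePoint {W : ℕ} (S : Finset (Fin W)) (w p : Fin W) : Prop :=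
  p ∈ S ∧ ∀ q ∈ S, |((p : ℕ) : ℤ) - ((w : ℕ) : ℤ)| ≤ |((q : ℕ) : ℤ) - ((w : ℕ) : ℤ)|

/-- Zeroth-order (nearest-neighbour) interpolation: the matrix on subcarrier `w` is replaced by
the one on the base point `near w`. -/
def interp0 {W : ℕ} {M : Type*} (near : Fin W → Fin W) (G : Fin W → M) (w : Fin W) : M :=
  G (near w)

/-- The squared error `|[G̃_w]_{m,n} - [G_w]_{m,n}|²` of zeroth-order interpolation. -/
def sqError0 {B U W L : ℕ} {Ω : Type*} (δ σ : ℝ) (h : Fin L → Fin B → Fin U → Ω → ℂ)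
    (e : Fin W → Fin B → Fin U → Ω → ℂ) (near : Fin W → Fin W) (w : Fin W) (m n : Fin U)
    (x : Ω) : ℝ :=
  ‖interp0 near (fun v => gram δ σ h e v x) w m n - gram δ σ h e w x m n‖ ^ 2

/-- The mean-squared error of zeroth-order interpolation in the entry `(m, n)`, subcarrier `w`. -/
def mse0 {B U W L : ℕ} {Ω : Type*} [MeasurableSpace Ω] (P : Measure Ω) (δ σ : ℝ)
    (h : Fin L → Fin B → Fin U → Ω → ℂ) (e : Fin W → Fin B → Fin U → Ω → ℂ)
    (near : Fin W → Fin W) (w : Fin W) (m n : Fin U) : ℝ :=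
  ∫ x, sqError0 δ σ h e near w m n x ∂P

/-- The scaled Fejér kernel `f_L(φ) = L⁻² (1 - cos (L φ)) / (1 - cos φ)`, extended by its limit `1`
to the multiples of `2π`. -/
def fejer (L : ℕ) (φ : ℝ) : ℝ :=
  if Real.cos φ = 1 then 1
  else ((L : ℝ) ^ 2)⁻¹ * ((1 - Real.cos ((L : ℝ) * φ)) / (1 - Real.cos φ))

/-- The channel-estimation error term `ε_CSI = 2 σ² (2 + B σ²)`. -/
def epsCSI (B : ℕ) (σ : ℝ) : ℝ := 2 * σ ^ 2 * (2 + (B : ℝ) * σ ^ 2)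

end

/-! Every entry of the frequency-domain channel is a linear form in independent circularly-symmetric
Gaussians, so Wick's formula (`integral_star_mul_mul_linear`) evaluates all second moments of Gram
entries. In E[G_w conj(G_p)] at a fixed entry (m, n), one pairing is the product of the means, which
is the same for all w and p; the other is C(w,p) = `covEnergy`, the sum over antenna pairs of
|covariance|². The means cancel in the squared error, which leaves C(p,p) + C(w,w) - 2 C(p,w)
(`IsChannelModel.mse0_eq`).

Let K = R^{1/2} (R^{1/2})^H and let c be the mean over the L taps of the relative phases. The
covariance matrix of subcarriers w and p is cK/B, plus σ²I if w = p. The B(B-1) off-diagonal entries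
of K/B have size about |δ|/B and carry energy δ² in the limit. The diagonal and the noise only add
terms of order 1/B, σ² and Bσ⁴, which vanish (`tendsto_noisyCorrEnergy`). Hence C(w,w) → δ² and, for
p ≠ w, C(p,w) → |c|²δ² with |c|² = f_L (`normSq_phaseCorr`).

For the equivalence, distinct subcarriers have a relative phase z ≠ 1 per tap, and for L ≥ 2 the
mean of 1, z, …, z^{L-1} then has modulus below 1 (`fejer_lt_one`). -/

section Moments

/-! ### Moments of real and circularly-symmetric complex Gaussians -/

lemma integrable_pow_gaussianReal (μ : ℝ) (v : ℝ≥0) (n : ℕ) :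
    Integrable (fun x : ℝ => x ^ n) (gaussianReal μ v) := by
  have h := integrable_pow_of_mem_interior_integrableExpSet
    (X := fun x : ℝ => x) (μ := gaussianReal μ v) (by simp) n
  exact h

lemma integral_sq_gaussianReal (v : ℝ≥0) : ∫ x, x ^ 2 ∂gaussianReal 0 v = v := by
  have h := variance_fun_id_gaussianReal (μ := 0) (v := v)
  rw [variance_eq_integral measurable_id'.aemeasurable] at h
  simpa using h

lemma integral_pow_four_gaussianReal (v : ℝ≥0) : ∫ x, x ^ 4 ∂gaussianReal 0 v = 3 * (v : ℝ) ^ 2 := by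
  have h := iteratedDeriv_mgf_zero (X := fun x : ℝ => x) (μ := gaussianReal 0 v) (by simp) 4
  have h' : ∫ x, x ^ 4 ∂gaussianReal 0 v = iteratedDeriv 4 (mgf (fun x ↦ x) (gaussianReal 0 v)) 0 :=
    h.symm
  rw [h', mgf_fun_id_gaussianReal]
  have hE : ∀ t : ℝ, HasDerivAt (fun t : ℝ => Real.exp (0 * t + v * t ^ 2 / 2))
      (v * t * Real.exp (0 * t + v * t ^ 2 / 2)) t := fun t => by
    have h1 : HasDerivAt (fun t : ℝ => 0 * t + (v : ℝ) * t ^ 2 / 2) (v * t) t := by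
      have h := (((hasDerivAt_id' t).fun_pow 2).const_mul (v : ℝ)).div_const 2
      refine (((hasDerivAt_id' t).const_mul (0 : ℝ)).fun_add h).congr_deriv ?_
      simp
      ring
    exact h1.exp.congr_deriv (by ring)
  -- Each derivative of p·exp(vt²/2) is again a polynomial times the same exponential, with p
  -- replaced by p' + pvt. The fourth moment is the fourth derivative at 0.
  have hP : ∀ (p p' : ℝ → ℝ), (∀ t, HasDerivAt p (p' t) t) →
      deriv (fun t => p t * Real.exp (0 * t + v * t ^ 2 / 2)) =
        fun t => (p' t + p t * (v * t)) * Real.exp (0 * t + v * t ^ 2 / 2) := by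
    intro p p' hp
    ext t
    rw [((hp t).fun_mul (hE t)).deriv]
    ring
  have hid : ∀ t : ℝ, HasDerivAt (fun t : ℝ => (v : ℝ) * t) v t := fun t => by
    simpa using (hasDerivAt_id t).const_mul (v : ℝ)
  have h2 : ∀ t : ℝ, HasDerivAt (fun t : ℝ => (v : ℝ) + v * t * (v * t)) (2 * v ^ 2 * t) t :=
    fun t => by
      exact (((hid t).fun_mul (hid t)).const_add (v : ℝ)).congr_deriv (by ring)
  have h3 : ∀ t : ℝ, HasDerivAt
      (fun t : ℝ => 2 * (v : ℝ) ^ 2 * t + ((v : ℝ) + v * t * (v * t)) * (v * t))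
      (2 * v ^ 2 + (2 * v ^ 2 * t * (v * t) + ((v : ℝ) + v * t * (v * t)) * v)) t := fun t => by
    have h := (hasDerivAt_id' t).const_mul (2 * (v : ℝ) ^ 2)
    exact (h.fun_add ((h2 t).fun_mul (hid t))).congr_deriv (by rw [mul_one])
  have e1 : deriv (fun t : ℝ => Real.exp (0 * t + v * t ^ 2 / 2)) =
      fun t => v * t * Real.exp (0 * t + v * t ^ 2 / 2) := funext fun t => (hE t).deriv
  rw [iteratedDeriv_succ, iteratedDeriv_succ, iteratedDeriv_succ, iteratedDeriv_one, e1,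
    hP _ _ hid, hP _ _ h2, hP _ _ h3]
  simp
  ring

instance (v : ℝ≥0) : IsProbabilityMeasure (complexGaussian v) :=
  Measure.isProbabilityMeasure_map (by fun_prop)

lemma integral_complexGaussian (v : ℝ≥0) {f : ℂ → ℂ} (hf : Continuous f) :
    ∫ z, f z ∂complexGaussian v =
      ∫ q : ℝ × ℝ, f ((q.1 : ℂ) + (q.2 : ℂ) * Complex.I)
        ∂((gaussianReal 0 (v / 2)).prod (gaussianReal 0 (v / 2))) := by
  rw [complexGaussian, integral_map (by fun_prop) hf.aestronglyMeasurable]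

/-- The quarter turn (x, y) ↦ (-y, x) swaps two identically distributed symmetric coordinates. It is
the only part of circular symmetry that is needed. -/
lemma complexGaussian_map_I_mul (v : ℝ≥0) :
    (complexGaussian v).map (fun z => Complex.I * z) = complexGaussian v := by
  have hneg : (gaussianReal 0 (v / 2)).map (fun x => -x) = gaussianReal 0 (v / 2) := by
    rw [gaussianReal_map_neg, neg_zero]
  have h1 : ((gaussianReal 0 (v / 2)).prod (gaussianReal 0 (v / 2))).map
      (fun q : ℝ × ℝ => (-q.2, q.1)) = (gaussianReal 0 (v / 2)).prod (gaussianReal 0 (v / 2)) := by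
    have hs : MeasurePreserving (Prod.swap : ℝ × ℝ → ℝ × ℝ)
        ((gaussianReal 0 (v / 2)).prod (gaussianReal 0 (v / 2)))
        ((gaussianReal 0 (v / 2)).prod (gaussianReal 0 (v / 2))) :=
      Measure.measurePreserving_swap
    have hn : MeasurePreserving (fun x : ℝ => -x) (gaussianReal 0 (v / 2))
        (gaussianReal 0 (v / 2)) := ⟨measurable_neg, hneg⟩
    have := (hn.prod (MeasurePreserving.id (gaussianReal 0 (v / 2)))).comp hs
    exact this.map_eq
  conv_rhs => rw [complexGaussian, ← h1]
  rw [complexGaussian, Measure.map_map (by fun_prop) (by fun_prop),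
    Measure.map_map (by fun_prop) (by fun_prop)]
  congr 1
  ext q
  simp
  linear_combination (q.2 : ℂ) * Complex.I_mul_I

lemma memLp_complexGaussian (v : ℝ≥0) : MemLp (fun z : ℂ => z) 4 (complexGaussian v) := by
  have hg : MemLp (fun x : ℝ => x) 4 (gaussianReal 0 (v / 2)) :=
    memLp_id_gaussianReal' 4 (by simp)
  rw [complexGaussian, memLp_map_measure_iff (by fun_prop) (by fun_prop)]
  have h1 : MemLp (fun q : ℝ × ℝ => (q.1 : ℂ)) 4
      ((gaussianReal 0 (v / 2)).prod (gaussianReal 0 (v / 2))) :=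
    (hg.comp_measurePreserving measurePreserving_fst).ofReal
  have h2 : MemLp (fun q : ℝ × ℝ => (q.2 : ℂ)) 4
      ((gaussianReal 0 (v / 2)).prod (gaussianReal 0 (v / 2))) :=
    (hg.comp_measurePreserving measurePreserving_snd).ofReal
  exact h1.add (h2.mul_const Complex.I)

/-- Invariance under z ↦ iz multiplies the moment by (-i)^a i^b, so it vanishes unless that factor
is 1. For a, b ≤ 2 the factor is 1 only if a = b. -/
lemma integral_moment_complexGaussian_of_ne (v : ℝ≥0) {a b : ℕ}
    (hab : (-Complex.I) ^ a * Complex.I ^ b ≠ 1) :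
    ∫ z, star z ^ a * z ^ b ∂complexGaussian v = 0 := by
  have h : ∫ z, star z ^ a * z ^ b ∂complexGaussian v =
      (-Complex.I) ^ a * Complex.I ^ b * ∫ z, star z ^ a * z ^ b ∂complexGaussian v := by
    conv_lhs => rw [← complexGaussian_map_I_mul]
    rw [integral_map (by fun_prop) (by fun_prop), ← integral_const_mul]
    congr 1
    ext z
    simp [mul_pow]
    ring
  have h' : (1 - (-Complex.I) ^ a * Complex.I ^ b) *
      ∫ z, star z ^ a * z ^ b ∂complexGaussian v = 0 := by
    linear_combination h
  exact (mul_eq_zero.mp h').resolve_left (sub_ne_zero.mpr hab.symm)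

lemma integral_normSq_complexGaussian (v : ℝ≥0) :
    ∫ z, star z * z ∂complexGaussian v = v := by
  rw [integral_complexGaussian v (by fun_prop)]
  have e : ∀ q : ℝ × ℝ, star ((q.1 : ℂ) + (q.2 : ℂ) * Complex.I) *
      ((q.1 : ℂ) + (q.2 : ℂ) * Complex.I) = ((q.1 ^ 2 * 1 + 1 * q.2 ^ 2 : ℝ) : ℂ) := fun q => by
    simp
    linear_combination -(q.2 : ℂ) ^ 2 * Complex.I_mul_I
  simp_rw [e]
  rw [integral_complex_ofReal]
  have i2 := integrable_pow_gaussianReal 0 (v / 2) 2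
  have i0 : Integrable (fun _ : ℝ => (1 : ℝ)) (gaussianReal 0 (v / 2)) := integrable_const 1
  rw [integral_add (i2.mul_prod i0) (i0.mul_prod i2),
    integral_prod_mul (fun x : ℝ => x ^ 2) (fun _ : ℝ => (1 : ℝ)),
    integral_prod_mul (fun _ : ℝ => (1 : ℝ)) (fun x : ℝ => x ^ 2), integral_sq_gaussianReal]
  simp

lemma integral_normSq_sq_complexGaussian (v : ℝ≥0) :
    ∫ z, star z ^ 2 * z ^ 2 ∂complexGaussian v = 2 * (v : ℂ) ^ 2 := by
  rw [integral_complexGaussian v (by fun_prop)]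
  have e : ∀ q : ℝ × ℝ, star ((q.1 : ℂ) + (q.2 : ℂ) * Complex.I) ^ 2 *
      ((q.1 : ℂ) + (q.2 : ℂ) * Complex.I) ^ 2 =
      ((q.1 ^ 4 * 1 + 2 * (q.1 ^ 2 * q.2 ^ 2) + 1 * q.2 ^ 4 : ℝ) : ℂ) := fun q => by
    have e1 : star ((q.1 : ℂ) + (q.2 : ℂ) * Complex.I) * ((q.1 : ℂ) + (q.2 : ℂ) * Complex.I) =
        (q.1 : ℂ) ^ 2 + (q.2 : ℂ) ^ 2 := by
      simp
      linear_combination -(q.2 : ℂ) ^ 2 * Complex.I_mul_I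
    rw [← mul_pow, e1]
    push_cast
    ring
  simp_rw [e]
  rw [integral_complex_ofReal]
  have i2 := integrable_pow_gaussianReal 0 (v / 2) 2
  have i4 := integrable_pow_gaussianReal 0 (v / 2) 4
  have i0 : Integrable (fun _ : ℝ => (1 : ℝ)) (gaussianReal 0 (v / 2)) := integrable_const 1
  rw [integral_add (f := fun q : ℝ × ℝ => q.1 ^ 4 * 1 + 2 * (q.1 ^ 2 * q.2 ^ 2))
      ((i4.mul_prod i0).add ((i2.mul_prod i2).const_mul 2)) (i0.mul_prod i4),
    integral_add (i4.mul_prod i0) ((i2.mul_prod i2).const_mul 2), integral_const_mul,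
    integral_prod_mul (fun x : ℝ => x ^ 4) (fun _ : ℝ => (1 : ℝ)),
    integral_prod_mul (fun x : ℝ => x ^ 2) (fun x : ℝ => x ^ 2),
    integral_prod_mul (fun _ : ℝ => (1 : ℝ)) (fun x : ℝ => x ^ 4), integral_sq_gaussianReal,
    integral_pow_four_gaussianReal]
  simp
  ring

/-- The mixed moments `E[conj(z)^a z^b]` of order `a, b ≤ 2` of a circularly-symmetric complex
Gaussian. -/
lemma integral_moment_complexGaussian (v : ℝ≥0) {a b : ℕ} (ha : a ≤ 2) (hb : b ≤ 2) :
    ∫ z, star z ^ a * z ^ b ∂complexGaussian v =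
      if a = b then (a.factorial : ℂ) * (v : ℂ) ^ a else 0 := by
  split_ifs with hab
  · subst hab
    interval_cases a
    · simp
    · simpa using integral_normSq_complexGaussian v
    · simpa using integral_normSq_sq_complexGaussian v
  · apply integral_moment_complexGaussian_of_ne
    interval_cases a <;> interval_cases b <;>
      first | exact absurd rfl hab | (simp [Complex.ext_iff, pow_succ] ; try norm_num)

end Moments

/-! ### Wick's formula for fourth moments -/

section Wick

variable {Ω ι : Type*} [MeasurableSpace Ω] {P : Measure Ω} [Fintype ι] {Z : ι → Ω → ℂ}
  {v : ι → ℝ≥0}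

lemma memLp_of_hasLaw_complexGaussian {X : Ω → ℂ} {s : ℝ≥0}
    (hX : HasLaw X (complexGaussian s) P) : MemLp X 4 P := by
  have h := memLp_complexGaussian s
  rw [← hX.map_eq, memLp_map_measure_iff (by fun_prop) hX.aemeasurable] at h
  exact h

lemma memLp_two_star_mul {X Y : Ω → ℂ} (hX : MemLp X 4 P) (hY : MemLp Y 4 P) :
    MemLp (fun x => star (X x) * Y x) 2 P := by
  have : ENNReal.HolderTriple 4 4 2 := ⟨by
    rw [← two_mul, show (4 : ENNReal) = 2 * 2 by norm_num,
      ENNReal.mul_inv (by simp) (by simp), ← mul_assoc,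
      ENNReal.mul_inv_cancel (by simp) (by simp), one_mul]⟩
  exact hY.mul' hX.star

lemma integrable_star_mul_mul {X₁ X₂ X₃ X₄ : Ω → ℂ} (h₁ : MemLp X₁ 4 P) (h₂ : MemLp X₂ 4 P)
    (h₃ : MemLp X₃ 4 P) (h₄ : MemLp X₄ 4 P) :
    Integrable (fun x => star (X₁ x) * X₂ x * (X₃ x * star (X₄ x))) P := by
  have h := (memLp_two_star_mul h₁ h₂).integrable_mul (memLp_two_star_mul h₄ h₃)
  refine h.congr (Eventually.of_forall fun x => ?_)
  simp only [Pi.mul_apply]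
  ring

/-- Wick's formula for the entries of an independent family of circularly-symmetric complex
Gaussians. -/
lemma integral_star_mul_mul_of_indep [DecidableEq ι]
    (hlaw : ∀ i, HasLaw (Z i) (complexGaussian (v i)) P) (hind : iIndepFun Z P) (i j k l : ι) :
    ∫ x, star (Z i x) * Z j x * (Z k x * star (Z l x)) ∂P =
      (if i = j ∧ k = l then (v i : ℂ) * v k else 0) +
        (if i = k ∧ j = l then (v i : ℂ) * v j else 0) := by
  -- `a s` and `b s` count the conjugated and plain occurrences of `Z s`. By independence the
  -- expectation is a product of single-variable moments, nonzero only if the multisets {i, l} and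
  -- {j, k} agree.
  set a : ι → ℕ := fun s => (if s = i then 1 else 0) + (if s = l then 1 else 0) with ha
  set b : ι → ℕ := fun s => (if s = j then 1 else 0) + (if s = k then 1 else 0) with hb
  have ha2 : ∀ s, a s ≤ 2 := fun s => by simp only [ha]; split_ifs <;> omega
  have hb2 : ∀ s, b s ≤ 2 := fun s => by simp only [hb]; split_ifs <;> omega
  have hprod : ∀ x, star (Z i x) * Z j x * (Z k x * star (Z l x)) =
      ∏ s, (star (Z s x) ^ a s * Z s x ^ b s) := fun x => by
    simp only [ha, hb, pow_add, Finset.prod_mul_distrib, pow_ite, pow_one, pow_zero,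
      Finset.prod_ite_eq', Finset.mem_univ, if_true]
    ring
  have hmom : ∀ s, ∫ x, star (Z s x) ^ a s * Z s x ^ b s ∂P =
      if a s = b s then ((a s).factorial : ℂ) * (v s : ℂ) ^ a s else 0 := fun s => by
    rw [← integral_moment_complexGaussian (v s) (ha2 s) (hb2 s)]
    exact (hlaw s).integral_comp (f := fun z : ℂ => star z ^ a s * z ^ b s)
      (by fun_prop)
  simp_rw [hprod]
  rw [hind.integral_fun_prod_comp (f := fun s z => star z ^ a s * z ^ b s)
    (fun s => (hlaw s).aemeasurable) (fun s => by fun_prop)]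
  simp_rw [hmom]
  by_cases hab : ∀ s, a s = b s
  · have hfac : ∀ s, ((a s).factorial : ℂ) = if s = i then (if i = l then 2 else 1) else 1 :=
      fun s => by
        simp only [ha]
        split_ifs <;> simp_all
    simp only [hab, if_true]
    simp only [← hab, Finset.prod_mul_distrib, hfac]
    simp only [Finset.prod_ite_eq', Finset.mem_univ, if_true, ha, pow_add, Finset.prod_mul_distrib,
      pow_ite, pow_one, pow_zero]
    have hi := hab i
    have hl := hab l
    have hj := hab j
    simp only [ha, hb] at hi hl hj
    by_cases hil : i = l
    · subst hil
      have : i = j := by by_contra h; simp only [h, if_true, if_false] at hi; split_ifs at hi <;> omega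
      subst this
      have : i = k := by by_contra h; simp only [h, if_true, if_false] at hi; omega
      subst this
      simp
      ring
    · by_cases hij : i = j
      · subst hij
        have : k = l := by by_contra h; simp [Ne.symm hil, Ne.symm h] at hl
        subst this
        simp [hil]
      · have h1 : i = k := by by_contra h; simp [hij, h] at hi
        subst h1
        have : j = l := by by_contra h; simp [h, Ne.symm hij] at hj
        subst this
        simp [hil]
  · have hz : ¬ (i = j ∧ k = l) ∧ ¬ (i = k ∧ j = l) := by
      refine ⟨?_, ?_⟩ <;> rintro ⟨rfl, rfl⟩ <;> apply hab <;> intro s <;> simp only [ha, hb]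
      omega
    push Not at hab
    obtain ⟨s, hs⟩ := hab
    rw [Finset.prod_eq_zero (Finset.mem_univ s) (if_neg hs), if_neg hz.1, if_neg hz.2, add_zero]

lemma memLp_sum_mul (hlaw : ∀ i, HasLaw (Z i) (complexGaussian (v i)) P) (a : ι → ℂ) :
    MemLp (fun x => ∑ i, a i * Z i x) 4 P :=
  memLp_finsetSum _ fun i _ => (memLp_of_hasLaw_complexGaussian (hlaw i)).const_mul (a i)

/-- Wick's formula for linear forms in an independent family of circularly-symmetric complex
Gaussians. -/
lemma integral_star_mul_mul_linear
    (hlaw : ∀ i, HasLaw (Z i) (complexGaussian (v i)) P) (hind : iIndepFun Z P)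
    (a₁ a₂ a₃ a₄ : ι → ℂ) :
    ∫ x, star (∑ i, a₁ i * Z i x) * (∑ i, a₂ i * Z i x) *
        ((∑ i, a₃ i * Z i x) * star (∑ i, a₄ i * Z i x)) ∂P =
      (∑ i, star (a₁ i) * a₂ i * v i) * (∑ i, a₃ i * star (a₄ i) * v i) +
        (∑ i, star (a₁ i) * a₃ i * v i) * (∑ i, a₂ i * star (a₄ i) * v i) := by
  classical
  have hexp : ∀ x, star (∑ i, a₁ i * Z i x) * (∑ i, a₂ i * Z i x) *
        ((∑ i, a₃ i * Z i x) * star (∑ i, a₄ i * Z i x)) =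
      ∑ i, ∑ j, ∑ k, ∑ l, star (a₁ i) * a₂ j * (a₃ k * star (a₄ l)) *
        (star (Z i x) * Z j x * (Z k x * star (Z l x))) := fun x => by
    simp only [star_sum, star_mul']
    rw [Finset.sum_mul_sum, Finset.sum_mul]
    refine Finset.sum_congr rfl fun i _ => ?_
    rw [Finset.sum_mul]
    refine Finset.sum_congr rfl fun j _ => ?_
    rw [Finset.sum_mul_sum, Finset.mul_sum]
    refine Finset.sum_congr rfl fun k _ => ?_
    rw [Finset.mul_sum]
    exact Finset.sum_congr rfl fun l _ => by ring
  have hmem := fun i => memLp_of_hasLaw_complexGaussian (hlaw i)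
  have hint : ∀ i j k l, Integrable (fun x => star (a₁ i) * a₂ j * (a₃ k * star (a₄ l)) *
        (star (Z i x) * Z j x * (Z k x * star (Z l x)))) P := fun i j k l =>
    (integrable_star_mul_mul (hmem i) (hmem j) (hmem k) (hmem l)).const_mul _
  simp_rw [hexp]
  rw [integral_finsetSum _ fun i _ => integrable_finsetSum _ fun j _ => integrable_finsetSum _
    fun k _ => integrable_finsetSum _ fun l _ => hint i j k l]
  have e : ∀ i, ∫ x, ∑ j, ∑ k, ∑ l, star (a₁ i) * a₂ j * (a₃ k * star (a₄ l)) *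
        (star (Z i x) * Z j x * (Z k x * star (Z l x))) ∂P =
      ∑ j, ∑ k, ∑ l, star (a₁ i) * a₂ j * (a₃ k * star (a₄ l)) *
        ((if i = j then (if k = l then (v i : ℂ) * v k else 0) else 0) +
        (if i = k then (if j = l then (v i : ℂ) * v j else 0) else 0)) := fun i => by
    rw [integral_finsetSum _ fun j _ => integrable_finsetSum _
      fun k _ => integrable_finsetSum _ fun l _ => hint i j k l]
    refine Finset.sum_congr rfl fun j _ => ?_
    rw [integral_finsetSum _ fun k _ => integrable_finsetSum _ fun l _ => hint i j k l]
    refine Finset.sum_congr rfl fun k _ => ?_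
    rw [integral_finsetSum _ fun l _ => hint i j k l]
    refine Finset.sum_congr rfl fun l _ => ?_
    rw [integral_const_mul, integral_star_mul_mul_of_indep hlaw hind]
    simp only [ite_and]
  simp_rw [e]
  simp only [mul_add, Finset.sum_add_distrib, mul_ite, mul_zero, Finset.sum_ite_irrel,
    Finset.sum_const_zero, Finset.sum_ite_eq, Finset.mem_univ, if_true]
  congr 1
  · rw [Finset.sum_mul_sum]
    exact Finset.sum_congr rfl fun i _ => Finset.sum_congr rfl fun j _ => by ring
  · rw [Finset.sum_mul_sum]
    exact Finset.sum_congr rfl fun i _ => Finset.sum_congr rfl fun j _ => by ring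

end Wick

/-! ### Covariances of the frequency-domain channel entries -/

noncomputable section Covariance

/-- The phase factor of tap `ℓ` on subcarrier `w`. -/
def tapPhase (W : ℕ) {L : ℕ} (w : Fin W) (ℓ : Fin L) : ℂ :=
  Complex.exp (-(Complex.I * 2 * (Real.pi : ℂ) * ((w : ℕ) : ℂ) * ((ℓ : ℕ) : ℂ) / (W : ℂ)))

/-- The normalized correlation of the phase factors of two subcarriers. -/
def phaseCorr (L : ℕ) {W : ℕ} (w p : Fin W) : ℂ :=
  (∑ ℓ : Fin L, tapPhase W w ℓ * star (tapPhase W p ℓ)) / L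

/-- The off-diagonal entry of `R^{1/2} (R^{1/2})^H`. -/
def corrOffDiag (B : ℕ) (δ : ℝ) : ℝ := (|1 + ((B : ℝ) - 1) * δ| - (1 - δ)) / B

/-- The covariance of the entries `(b, u)` and `(b', u)` of the frequency-domain channel matrices
on the subcarriers `w` and `p`. -/
def channelCov (B L : ℕ) {W : ℕ} (δ σ : ℝ) (w p : Fin W) (b b' : Fin B) : ℂ :=
  phaseCorr L w p / B * ((if b = b' then ((1 - δ : ℝ) : ℂ) else 0) + (corrOffDiag B δ : ℂ)) +
    if w = p ∧ b = b' then (σ : ℂ) ^ 2 else 0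

/-- The independent Gaussian entries of the channel model as a single family. -/
def modelFamily {B U W L : ℕ} {Ω : Type*} (h : Fin L → Fin B → Fin U → Ω → ℂ)
    (e : Fin W → Fin B → Fin U → Ω → ℂ) :
    (Fin L × Fin B × Fin U) ⊕ (Fin W × Fin B × Fin U) → Ω → ℂ :=
  Sum.elim (fun i => h i.1 i.2.1 i.2.2) (fun i => e i.1 i.2.1 i.2.2)

/-- The variances of the entries of `modelFamily`. -/
def modelVar (B U W L : ℕ) : (Fin L × Fin B × Fin U) ⊕ (Fin W × Fin B × Fin U) → ℝ≥0 :=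
  Sum.elim (fun _ => 1 / ((B : ℝ≥0) * (L : ℝ≥0))) (fun _ => 1)

/-- The coefficients of the entry `(b, u)` of the channel matrix on subcarrier `w`, as a linear form
in `modelFamily`. -/
def channelCoeff {B U W L : ℕ} (δ σ : ℝ) (w : Fin W) (b : Fin B) (u : Fin U) :
    (Fin L × Fin B × Fin U) ⊕ (Fin W × Fin B × Fin U) → ℂ :=
  Sum.elim (fun i => if i.2.2 = u then tapPhase W w i.1 * corrSqrt B δ b i.2.1 else 0)
    (fun i => if i.1 = w then (if i.2.1 = b then (if i.2.2 = u then (σ : ℂ) else 0) else 0) else 0)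

lemma IsChannelModel.hasLaw_modelFamily {B U W L : ℕ} {Ω : Type*} [MeasurableSpace Ω]
    {P : Measure Ω} {h : Fin L → Fin B → Fin U → Ω → ℂ} {e : Fin W → Fin B → Fin U → Ω → ℂ}
    (H : IsChannelModel P h e) (i) :
    HasLaw (modelFamily h e i) (complexGaussian (modelVar B U W L i)) P := by
  rcases i with i | i
  · exact H.law_h i.1 i.2.1 i.2.2
  · exact H.law_e i.1 i.2.1 i.2.2

lemma freqChannel_apply {B U W L : ℕ} {Ω : Type*} (δ σ : ℝ)
    (h : Fin L → Fin B → Fin U → Ω → ℂ) (e : Fin W → Fin B → Fin U → Ω → ℂ) (w : Fin W) (x : Ω)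
    (b : Fin B) (u : Fin U) :
    freqChannel δ σ h e w x b u = ∑ i, channelCoeff δ σ w b u i * modelFamily h e i x := by
  simp only [freqChannel, timeChannel, channelCoeff, modelFamily, tapPhase, Fintype.sum_sum_type,
    Fintype.sum_prod_type, Sum.elim_inl, Sum.elim_inr, Matrix.add_apply, Matrix.sum_apply,
    Matrix.smul_apply, Matrix.mul_apply, Matrix.of_apply, smul_eq_mul, ite_mul, zero_mul,
    Finset.sum_ite_eq', Finset.sum_ite_irrel, Finset.sum_const_zero, Finset.mem_univ, if_true,
    Finset.mul_sum]
  congr 1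
  exact Finset.sum_congr rfl fun ℓ _ => Finset.sum_congr rfl fun b' _ => by ring

/-- Only the squared moduli |1 - δ| and |1 + (B-1)δ| of the eigenvalues of R^{1/2} enter. Hence no
positivity of R is needed: if 1 + (B-1)δ < 0 the root is not Hermitian, and the sum is not the entry
of R. -/
lemma sum_corrSqrt_mul_star (B : ℕ) (δ : ℝ) (hδ : δ ^ 2 ≤ 1) (b b' : Fin B) :
    ∑ k, corrSqrt B δ b k * star (corrSqrt B δ b' k) =
      (if b = b' then ((1 - δ : ℝ) : ℂ) else 0) + (corrOffDiag B δ : ℂ) := by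
  have hB : (B : ℂ) ≠ 0 := by
    have := b.pos
    exact_mod_cast this.ne'
  have hnorm : ∀ r : ℝ, ((r : ℂ) ^ (2⁻¹ : ℂ)) * star ((r : ℂ) ^ (2⁻¹ : ℂ)) = ((|r| : ℝ) : ℂ) :=
    fun r => by
      have h1 : ‖(r : ℂ) ^ (2⁻¹ : ℂ)‖ ^ 2 = |r| := by
        rw [← norm_pow, ← Complex.cpow_nat_mul]
        simp
      rw [Complex.star_def, Complex.mul_conj, Complex.normSq_eq_norm_sq, h1]
  have ha := hnorm (1 - δ)
  have hc := hnorm (1 + ((B : ℝ) - 1) * δ)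
  rw [abs_of_nonneg (by nlinarith : (0 : ℝ) ≤ 1 - δ)] at ha
  unfold corrSqrt corrOffDiag
  set a := ((1 - δ : ℝ) : ℂ) ^ (2⁻¹ : ℂ)
  set c := ((1 + ((B : ℝ) - 1) * δ : ℝ) : ℂ) ^ (2⁻¹ : ℂ)
  simp only [Matrix.add_apply, Matrix.smul_apply, Matrix.one_apply, Matrix.of_apply, smul_eq_mul,
    mul_one, mul_ite, mul_zero, star_add, add_mul, mul_add, apply_ite star, star_zero, ite_mul,
    zero_mul, Finset.sum_add_distrib, Finset.sum_ite_eq, Finset.mem_univ,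
    if_true, Finset.sum_const, Finset.card_univ, Fintype.card_fin, nsmul_eq_mul, star_div₀,
    star_sub, star_natCast]
  have key : (c - a) / B * star a + (a * ((star c - star a) / B) +
      B * ((c - a) / B * ((star c - star a) / B))) = (c * star c - a * star a) / B := by
    field_simp
    ring
  rw [ha, hc] at key
  push_cast at key ha ⊢
  rw [← key]
  by_cases hbb : b = b'
  · subst hbb
    simp only [if_true]
    linear_combination ha
  · simp only [hbb, if_false]
    ring

/-- The tap variance 1/(BL) splits into the 1/L that normalizes `phaseCorr` and a remaining 1/B.
Different users share no Gaussian variable, and different subcarriers share no noise. -/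
lemma sum_channelCoeff_mul_star {B U W L : ℕ} (δ σ : ℝ) (hδ : δ ^ 2 ≤ 1) (w p : Fin W)
    (b b' : Fin B) (u u' : Fin U) :
    ∑ i, channelCoeff (L := L) δ σ w b u i * star (channelCoeff δ σ p b' u' i) *
        modelVar B U W L i =
      if u = u' then channelCov B L δ σ w p b b' else 0 := by
  simp only [channelCoeff, modelVar, Fintype.sum_sum_type,
    Fintype.sum_prod_type, Sum.elim_inl, Sum.elim_inr, apply_ite star, star_zero, ite_mul, zero_mul,
    mul_ite, mul_zero, Finset.sum_ite_eq', Finset.sum_ite_irrel, Finset.sum_const_zero,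
    Finset.mem_univ, if_true]
  by_cases huu : u = u'
  · subst huu
    simp only [if_true, channelCov, ← sum_corrSqrt_mul_star B δ hδ b b', phaseCorr]
    congr 1
    · rw [div_div, Finset.sum_div, Finset.sum_mul_sum]
      refine Finset.sum_congr rfl fun ℓ _ => Finset.sum_congr rfl fun k _ => ?_
      push_cast
      rw [star_mul']
      ring
    · by_cases hwp : w = p
      · by_cases hbb : b = b'
        · simp [hwp, hbb, sq]
        · simp [hbb, Ne.symm hbb]
      · simp [hwp, Ne.symm hwp]
  · simp [huu, Ne.symm huu]

/-- The relative phase depends only on p - w, and its powers turn the sum over taps into a geometric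
sum. -/
lemma tapPhase_mul_star {W L : ℕ} (w p : Fin W) (ℓ : Fin L) :
    tapPhase W w ℓ * star (tapPhase W p ℓ) =
      Complex.exp (((2 * Real.pi / (W : ℝ) * (((p : ℕ) : ℝ) - ((w : ℕ) : ℝ)) : ℝ) : ℂ) *
        Complex.I) ^ (ℓ : ℕ) := by
  rw [tapPhase, tapPhase, Complex.star_def, ← Complex.exp_conj, ← Complex.exp_add,
    ← Complex.exp_nat_mul]
  congr 1
  simp only [map_neg, map_div₀, map_mul, map_ofNat, map_natCast, Complex.conj_I,
    Complex.conj_ofReal]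
  push_cast
  ring

lemma phaseCorr_self {W L : ℕ} (hL : 1 ≤ L) (w : Fin W) : phaseCorr L w w = 1 := by
  have hL' : (L : ℂ) ≠ 0 := by exact_mod_cast (by omega : L ≠ 0)
  simp_rw [phaseCorr, tapPhase_mul_star]
  simp [hL']

lemma phaseCorr_star {W L : ℕ} (w p : Fin W) : star (phaseCorr L w p) = phaseCorr L p w := by
  simp only [phaseCorr, star_div₀, star_sum, star_mul', star_star, star_natCast, mul_comm]

lemma channelCov_star {B L W : ℕ} (δ σ : ℝ) (w p : Fin W) (b b' : Fin B) :
    star (channelCov B L δ σ w p b b') = channelCov B L δ σ p w b' b := by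
  have hs : star (phaseCorr L w p) = phaseCorr L p w := phaseCorr_star w p
  simp only [channelCov, star_add, star_mul', star_div₀, hs, apply_ite star, star_pow, star_zero,
    star_natCast, Complex.star_def, Complex.conj_ofReal, eq_comm]

/-- The sum of the squared moduli of the covariances of two subcarriers. -/
def covEnergy (B L : ℕ) {W : ℕ} (δ σ : ℝ) (w p : Fin W) : ℝ :=
  ∑ b : Fin B, ∑ b' : Fin B, ‖channelCov B L δ σ w p b b'‖ ^ 2

lemma covEnergy_comm {B L W : ℕ} (δ σ : ℝ) (w p : Fin W) :
    covEnergy B L δ σ w p = covEnergy B L δ σ p w := by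
  rw [covEnergy, covEnergy, Finset.sum_comm]
  refine Finset.sum_congr rfl fun b _ => Finset.sum_congr rfl fun b' _ => ?_
  rw [← channelCov_star, norm_star]

end Covariance

/-! ### The exact mean-squared error -/

section MeanSquaredError

lemma gram_apply {B U W L : ℕ} {Ω : Type*} (δ σ : ℝ) (h : Fin L → Fin B → Fin U → Ω → ℂ)
    (e : Fin W → Fin B → Fin U → Ω → ℂ) (w : Fin W) (x : Ω) (m n : Fin U) :
    gram δ σ h e w x m n =
      ∑ b, star (freqChannel δ σ h e w x b m) * freqChannel δ σ h e w x b n := by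
  simp [gram, Matrix.mul_apply]

variable {B U W L : ℕ} {Ω : Type*} [MeasurableSpace Ω] {P : Measure Ω}
  {h : Fin L → Fin B → Fin U → Ω → ℂ} {e : Fin W → Fin B → Fin U → Ω → ℂ}

lemma IsChannelModel.memLp_freqChannel (H : IsChannelModel P h e) (δ σ : ℝ) (w : Fin W)
    (b : Fin B) (u : Fin U) : MemLp (fun x => freqChannel δ σ h e w x b u) 4 P := by
  simp_rw [freqChannel_apply]
  exact memLp_sum_mul H.hasLaw_modelFamily _

lemma IsChannelModel.memLp_gram (H : IsChannelModel P h e) (δ σ : ℝ) (w : Fin W) (m n : Fin U) :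
    MemLp (fun x => gram δ σ h e w x m n) 2 P := by
  simp_rw [gram_apply]
  exact memLp_finsetSum _ fun b _ =>
    memLp_two_star_mul (H.memLp_freqChannel δ σ w b m) (H.memLp_freqChannel δ σ w b n)

lemma IsChannelModel.integrable_sqError0 (H : IsChannelModel P h e) (δ σ : ℝ)
    (near : Fin W → Fin W) (w : Fin W) (m n : Fin U) :
    Integrable (sqError0 δ σ h e near w m n) P :=
  ((H.memLp_gram δ σ (near w) m n).sub (H.memLp_gram δ σ w m n)).integrable_norm_pow
    (by norm_num)

lemma IsChannelModel.integrable_gram_mul_star (H : IsChannelModel P h e) (δ σ : ℝ) (w p : Fin W)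
    (m n : Fin U) :
    Integrable (fun x => gram δ σ h e w x m n * star (gram δ σ h e p x m n)) P :=
  (H.memLp_gram δ σ w m n).integrable_mul (H.memLp_gram δ σ p m n).star

/-- The first summand is the Wick pairing within each Gram entry, the product of the means. The
second pairs across the two subcarriers user by user, which gives a covariance times its conjugate
whether or not m = n. -/
lemma IsChannelModel.integral_gram_mul_star (H : IsChannelModel P h e) (hL : 1 ≤ L) {δ : ℝ}
    (hδ : δ ^ 2 ≤ 1) (σ : ℝ) (w p : Fin W) (m n : Fin U) :
    ∫ x, gram δ σ h e w x m n * star (gram δ σ h e p x m n) ∂P =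
      (if m = n then (B * (((1 - δ + corrOffDiag B δ) / B + σ ^ 2 : ℝ) : ℂ)) ^ 2 else 0) +
        (covEnergy B L δ σ w p : ℂ) := by
  have hexp : ∀ x, gram δ σ h e w x m n * star (gram δ σ h e p x m n) =
      ∑ b, ∑ b', star (freqChannel δ σ h e w x b m) * freqChannel δ σ h e w x b n *
        (freqChannel δ σ h e p x b' m * star (freqChannel δ σ h e p x b' n)) := fun x => by
    rw [gram_apply, gram_apply, star_sum, Finset.sum_mul_sum]
    refine Finset.sum_congr rfl fun b _ => Finset.sum_congr rfl fun b' _ => ?_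
    rw [star_mul', star_star]
  have hM := H.memLp_freqChannel δ σ
  have hterm : ∀ b b', ∫ x, star (freqChannel δ σ h e w x b m) * freqChannel δ σ h e w x b n *
        (freqChannel δ σ h e p x b' m * star (freqChannel δ σ h e p x b' n)) ∂P =
      (if m = n then (((1 - δ + corrOffDiag B δ) / B + σ ^ 2 : ℝ) : ℂ) ^ 2 else 0) +
        ((‖channelCov B L δ σ w p b b'‖ ^ 2 : ℝ) : ℂ) := fun b b' => by
    simp_rw [freqChannel_apply]
    rw [integral_star_mul_mul_linear H.hasLaw_modelFamily H.indep]
    simp_rw [mul_comm (star (channelCoeff δ σ w b m _))]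
    simp only [sum_channelCoeff_mul_star δ σ hδ, if_true]
    congr 1
    · by_cases hmn : m = n
      · simp only [hmn, if_true, channelCov, phaseCorr_self hL, and_self]
        push_cast
        ring
      · simp [hmn]
    · rw [← channelCov_star δ σ w p b b', mul_comm, Complex.star_def, Complex.mul_conj,
        Complex.normSq_eq_norm_sq]
  simp_rw [hexp]
  have hint := fun b b' => integrable_star_mul_mul (hM w b m) (hM w b n) (hM p b' m) (hM p b' n)
  rw [integral_finsetSum _ fun b _ => integrable_finsetSum _ fun b' _ => hint b b']
  have e1 : ∀ b, ∫ x, ∑ b', star (freqChannel δ σ h e w x b m) * freqChannel δ σ h e w x b n *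
        (freqChannel δ σ h e p x b' m * star (freqChannel δ σ h e p x b' n)) ∂P =
      ∑ b', ((if m = n then (((1 - δ + corrOffDiag B δ) / B + σ ^ 2 : ℝ) : ℂ) ^ 2 else 0) +
        ((‖channelCov B L δ σ w p b b'‖ ^ 2 : ℝ) : ℂ)) := fun b => by
    rw [integral_finsetSum _ fun b' _ => hint b b']
    exact Finset.sum_congr rfl fun b' _ => hterm b b'
  simp_rw [e1]
  simp only [Finset.sum_add_distrib, covEnergy, Complex.ofReal_sum, Finset.sum_const,
    Finset.card_univ, Fintype.card_fin, nsmul_eq_mul]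
  congr 1
  split_ifs <;> ring

/-- The exact mean-squared error in terms of the covariances of the channel matrices. -/
lemma IsChannelModel.mse0_eq (H : IsChannelModel P h e) (hL : 1 ≤ L) {δ : ℝ}
    (hδ : δ ^ 2 ≤ 1) (σ : ℝ) (near : Fin W → Fin W) (w : Fin W) (m n : Fin U) :
    mse0 P δ σ h e near w m n = covEnergy B L δ σ (near w) (near w) + covEnergy B L δ σ w w -
      2 * covEnergy B L δ σ (near w) w := by
  apply Complex.ofReal_injective
  rw [mse0, ← integral_complex_ofReal]
  set p := near w with hp
  have hexp : ∀ x, ((sqError0 δ σ h e near w m n x : ℝ) : ℂ) =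
      gram δ σ h e p x m n * star (gram δ σ h e p x m n) -
        gram δ σ h e p x m n * star (gram δ σ h e w x m n) -
        gram δ σ h e w x m n * star (gram δ σ h e p x m n) +
        gram δ σ h e w x m n * star (gram δ σ h e w x m n) := fun x => by
    rw [sqError0, interp0, ← Complex.normSq_eq_norm_sq, ← Complex.mul_conj, ← Complex.star_def,
      star_sub]
    ring
  simp_rw [hexp]
  have hi := fun a b => H.integrable_gram_mul_star δ σ a b m n
  have h1 := integral_sub (hi p p) (hi p w)
  have h2 := integral_sub ((hi p p).sub (hi p w)) (hi w p)
  have h3 := integral_add (((hi p p).sub (hi p w)).sub (hi w p)) (hi w w)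
  simp only [Pi.sub_apply] at h2 h3
  rw [h3, h2, h1]
  -- The mean terms do not depend on the subcarriers and occur with signs +, -, -, +, so they
  -- cancel.
  simp only [H.integral_gram_mul_star hL hδ σ]
  rw [covEnergy_comm δ σ w p]
  push_cast
  ring

end MeanSquaredError

/-! ### The Fejér kernel -/

section Fejer

lemma cos_eq_one_of_exp_mul_I_eq_one {φ : ℝ} (h : Complex.exp (φ * Complex.I) = 1) :
    Real.cos φ = 1 := by
  rw [← Complex.exp_ofReal_mul_I_re, h, Complex.one_re]

lemma normSq_one_sub_exp_mul_I (φ : ℝ) :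
    ‖1 - Complex.exp (φ * Complex.I)‖ ^ 2 = 2 * (1 - Real.cos φ) := by
  rw [← Complex.normSq_eq_norm_sq, Complex.normSq_apply]
  simp only [Complex.sub_re, Complex.sub_im, Complex.one_re, Complex.one_im,
    Complex.exp_ofReal_mul_I_re, Complex.exp_ofReal_mul_I_im]
  linear_combination Real.sin_sq_add_cos_sq φ

lemma exp_mul_I_eq_one_of_cos_eq_one {φ : ℝ} (h : Real.cos φ = 1) :
    Complex.exp (φ * Complex.I) = 1 := by
  have h1 := normSq_one_sub_exp_mul_I φ
  rw [h, sub_self, mul_zero] at h1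
  exact (sub_eq_zero.mp (norm_eq_zero.mp (pow_eq_zero_iff two_ne_zero |>.mp h1))).symm

lemma normSq_sum_exp_eq_fejer {L : ℕ} (hL : 1 ≤ L) (φ : ℝ) :
    ‖(∑ ℓ : Fin L, Complex.exp (φ * Complex.I) ^ (ℓ : ℕ)) / (L : ℂ)‖ ^ 2 = fejer L φ := by
  have hL' : (L : ℝ) ≠ 0 := by exact_mod_cast (by omega : L ≠ 0)
  rw [Fin.sum_univ_eq_sum_range (fun ℓ => Complex.exp (φ * Complex.I) ^ ℓ) L]
  unfold fejer
  split_ifs with hc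
  · rw [exp_mul_I_eq_one_of_cos_eq_one hc]
    have : (L : ℂ) ≠ 0 := by exact_mod_cast hL'
    simp [this]
  · have hne : Complex.exp (φ * Complex.I) ≠ 1 := fun h => hc (cos_eq_one_of_exp_mul_I_eq_one h)
    have hpow : Complex.exp (φ * Complex.I) ^ L =
        Complex.exp (((L : ℝ) * φ : ℝ) * Complex.I) := by
      rw [← Complex.exp_nat_mul]
      push_cast
      ring_nf
    rw [geom_sum_eq hne, norm_div, norm_div, ← norm_neg (_ - 1), neg_sub,
      ← norm_neg (Complex.exp (φ * Complex.I) - 1), neg_sub, div_pow, div_pow, hpow,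
      normSq_one_sub_exp_mul_I, normSq_one_sub_exp_mul_I, Complex.norm_natCast]
    have : 1 - Real.cos φ ≠ 0 := sub_ne_zero.mpr (Ne.symm hc)
    field_simp

/-- The triangle inequality is already strict on the first two terms: |1 + z| < 2 for a unit z ≠ 1,
and the other L - 2 terms have modulus 1. -/
lemma fejer_lt_one {L : ℕ} (hL : 2 ≤ L) {φ : ℝ} (hφ : Real.cos φ ≠ 1) : fejer L φ < 1 := by
  obtain ⟨k, rfl⟩ : ∃ k, L = k + 2 := ⟨L - 2, by omega⟩
  rw [← normSq_sum_exp_eq_fejer (by omega)]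
  set z := Complex.exp (φ * Complex.I) with hz
  have hz1 : ‖z‖ = 1 := Complex.norm_exp_ofReal_mul_I φ
  have h1 : ‖1 + z‖ < 2 := by
    have hsq : ‖1 + z‖ ^ 2 = 2 + 2 * Real.cos φ := by
      rw [← Complex.normSq_eq_norm_sq, Complex.normSq_apply]
      simp only [hz, Complex.add_re, Complex.add_im, Complex.one_re, Complex.one_im,
        Complex.exp_ofReal_mul_I_re, Complex.exp_ofReal_mul_I_im]
      linear_combination Real.sin_sq_add_cos_sq φ
    have hlt : Real.cos φ < 1 := lt_of_le_of_ne (Real.cos_le_one φ) hφ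
    nlinarith [norm_nonneg (1 + z)]
  have h2 : ‖∑ ℓ : Fin (k + 2), z ^ (ℓ : ℕ)‖ < (k : ℝ) + 2 := by
    rw [Fin.sum_univ_succ, Fin.sum_univ_succ]
    have h3 : ‖∑ i : Fin k, z ^ ((i.succ.succ : Fin (k + 2)) : ℕ)‖ ≤ k := by
      refine (norm_sum_le _ _).trans (le_of_eq ?_)
      simp [norm_pow, hz1]
    have h4 : z ^ ((0 : Fin (k + 2)) : ℕ) + (z ^ (((0 : Fin (k + 1)).succ : Fin (k + 2)) : ℕ) +
        ∑ i : Fin k, z ^ ((i.succ.succ : Fin (k + 2)) : ℕ)) =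
        (1 + z) + ∑ i : Fin k, z ^ ((i.succ.succ : Fin (k + 2)) : ℕ) := by
      simp
      ring
    rw [h4]
    calc _ ≤ _ := norm_add_le _ _
      _ < _ := by linarith
  rw [norm_div, Complex.norm_natCast, div_pow, div_lt_one (by positivity)]
  push_cast
  exact pow_lt_pow_left₀ h2 (norm_nonneg _) two_ne_zero

lemma fejer_zero (L : ℕ) : fejer L 0 = 1 := by
  simp [fejer]

lemma cos_phase_ne_one {W : ℕ} {p w : Fin W} (hpw : p ≠ w) :
    Real.cos (2 * Real.pi / (W : ℝ) * (((p : ℕ) : ℝ) - ((w : ℕ) : ℝ))) ≠ 1 := by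
  intro hc
  obtain ⟨n, hn⟩ := (Real.cos_eq_one_iff _).mp hc
  have hW : (W : ℝ) ≠ 0 := by exact_mod_cast p.pos.ne'
  have hn' : (n : ℝ) * W = ((p : ℕ) : ℝ) - ((w : ℕ) : ℝ) := by
    field_simp at hn
    have hpi := Real.pi_ne_zero
    have h2 : (2 * Real.pi) * ((n : ℝ) * W) =
        (2 * Real.pi) * (((p : ℕ) : ℝ) - ((w : ℕ) : ℝ)) := by linear_combination (2 * Real.pi) * hn
    exact mul_left_cancel₀ (by positivity) h2
  have hz : n * (W : ℤ) = ((p : ℕ) : ℤ) - ((w : ℕ) : ℤ) := by exact_mod_cast hn'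
  have hp := p.isLt
  have hw := w.isLt
  -- Since |p - w| < W, the only multiple of W available is 0.
  have hn0 : n = 0 := by
    by_contra hne
    rcases lt_or_gt_of_ne hne with h | h <;> nlinarith
  rw [hn0, zero_mul] at hz
  exact hpw (Fin.ext (by omega))

lemma normSq_phaseCorr {W L : ℕ} (hL : 1 ≤ L) (p w : Fin W) :
    ‖phaseCorr L w p‖ ^ 2 =
      fejer L (2 * Real.pi / (W : ℝ) * (((p : ℕ) : ℝ) - ((w : ℕ) : ℝ))) := by
  rw [← normSq_sum_exp_eq_fejer hL, phaseCorr]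
  simp_rw [tapPhase_mul_star]

end Fejer

/-! ### Large-antenna asymptotics of the covariance energies -/

noncomputable section Limit

/-- The squared Frobenius norm of `R^{1/2} (R^{1/2})^H / B + s I`. -/
def noisyCorrEnergy (B : ℕ) (δ s : ℝ) : ℝ :=
  B * (((1 - δ + corrOffDiag B δ) / B + s) ^ 2 + (B - 1) * (corrOffDiag B δ / B) ^ 2)

lemma sum_ite_eq_sq (B : ℕ) (x y : ℝ) :
    ∑ b : Fin B, ∑ b' : Fin B, (if b = b' then x else y) ^ 2 = B * (x ^ 2 + (B - 1) * y ^ 2) := by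
  have e : ∀ b b' : Fin B, (if b = b' then x else y) ^ 2 =
      (if b = b' then x ^ 2 - y ^ 2 else 0) + y ^ 2 := fun b b' => by split_ifs <;> ring
  simp only [e, Finset.sum_add_distrib, Finset.sum_ite_eq, Finset.mem_univ, if_true,
    Finset.sum_const, Finset.card_univ, Fintype.card_fin, nsmul_eq_mul]
  ring

lemma covEnergy_self {B L W : ℕ} (hL : 1 ≤ L) (δ σ : ℝ) (w : Fin W) :
    covEnergy B L δ σ w w = noisyCorrEnergy B δ (σ ^ 2) := by
  rw [noisyCorrEnergy, ← sum_ite_eq_sq, covEnergy]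
  refine Finset.sum_congr rfl fun b _ => Finset.sum_congr rfl fun b' _ => ?_
  rw [channelCov, phaseCorr_self hL, ← sq_abs (ite _ _ _), ← Real.norm_eq_abs,
    ← Complex.norm_real]
  congr 2
  by_cases hb : b = b' <;> simp [hb] <;> ring

/-- Noise on distinct subcarriers is uncorrelated, so s = 0 and the phase correlation factors out.
-/
lemma covEnergy_of_ne {B L W : ℕ} (δ σ : ℝ) {w p : Fin W} (hwp : w ≠ p) :
    covEnergy B L δ σ w p = ‖phaseCorr L w p‖ ^ 2 * noisyCorrEnergy B δ 0 := by
  rw [noisyCorrEnergy, ← sum_ite_eq_sq, covEnergy, Finset.mul_sum]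
  refine Finset.sum_congr rfl fun b _ => ?_
  rw [Finset.mul_sum]
  refine Finset.sum_congr rfl fun b' _ => ?_
  rw [channelCov, ← sq_abs (ite _ _ _), ← Real.norm_eq_abs, ← Complex.norm_real, ← mul_pow,
    ← norm_mul]
  congr 2
  by_cases hb : b = b' <;> simp [hb, hwp] <;> ring

lemma tendsto_corrOffDiag (δ : ℝ) :
    Tendsto (fun B : ℕ => corrOffDiag B δ) atTop (𝓝 |δ|) := by
  have h1 : Tendsto (fun B : ℕ => ((B : ℝ))⁻¹) atTop (𝓝 0) := tendsto_inv_atTop_nhds_zero_nat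
  have h2 : Tendsto (fun B : ℕ => |(B : ℝ)⁻¹ + (1 - (B : ℝ)⁻¹) * δ| - (1 - δ) * (B : ℝ)⁻¹) atTop
      (𝓝 (|0 + (1 - 0) * δ| - (1 - δ) * 0)) :=
    ((h1.add ((h1.const_sub 1).mul_const δ)).abs).sub (h1.const_mul (1 - δ))
  simp only [zero_add, sub_zero, one_mul, mul_zero] at h2
  refine h2.congr' ?_
  filter_upwards [eventually_gt_atTop 0] with B hB
  have hB' : (0 : ℝ) < B := by exact_mod_cast hB
  have e : (B : ℝ)⁻¹ + (1 - (B : ℝ)⁻¹) * δ = (1 + ((B : ℝ) - 1) * δ) / B := by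
    field_simp
  rw [corrOffDiag, e, abs_div, abs_of_pos hB']
  field_simp

lemma tendsto_noisyCorrEnergy (δ : ℝ) {s : ℕ → ℝ} (hs : Tendsto s atTop (𝓝 0))
    (hBs : Tendsto (fun B : ℕ => (B : ℝ) * s B ^ 2) atTop (𝓝 0)) :
    Tendsto (fun B : ℕ => noisyCorrEnergy B δ (s B)) atTop (𝓝 (δ ^ 2)) := by
  have h1 : Tendsto (fun B : ℕ => ((B : ℝ))⁻¹) atTop (𝓝 0) := tendsto_inv_atTop_nhds_zero_nat
  have hr := tendsto_corrOffDiag δ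
  have hq := hr.const_add (1 - δ)
  -- With r the off-diagonal entry and q = 1 - δ + r, the energy is q²/B + 2qs + Bs² + r²(1 - 1/B).
  have h2 := ((((hq.pow 2).mul h1).add ((hq.const_mul 2).mul hs)).add hBs).add
    ((hr.pow 2).mul (h1.const_sub 1))
  have hlim : (1 - δ + |δ|) ^ 2 * 0 + 2 * (1 - δ + |δ|) * 0 + 0 + |δ| ^ 2 * (1 - 0) = δ ^ 2 := by
    rw [sq_abs]
    ring
  rw [hlim] at h2
  refine h2.congr' ?_
  filter_upwards [eventually_gt_atTop 0] with B hB
  have hB' : (B : ℝ) ≠ 0 := by exact_mod_cast hB.ne'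
  rw [noisyCorrEnergy]
  field_simp
  ring

/-- ε_CSI = 4σ² + 2Bσ⁴ is a sum of nonnegative terms and so dominates both σ² and Bσ⁴. -/
lemma tendsto_sq_of_epsCSI {σ : ℕ → ℝ}
    (hCSI : Tendsto (fun B : ℕ => epsCSI B (σ B)) atTop (𝓝 0)) :
    Tendsto (fun B => σ B ^ 2) atTop (𝓝 0) := by
  refine squeeze_zero (fun B => sq_nonneg _) (fun B => ?_) hCSI
  have : 0 ≤ (B : ℝ) * (σ B ^ 2) ^ 2 := by positivity
  rw [epsCSI]
  nlinarith [sq_nonneg (σ B)]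

lemma tendsto_mul_sq_sq_of_epsCSI {σ : ℕ → ℝ}
    (hCSI : Tendsto (fun B : ℕ => epsCSI B (σ B)) atTop (𝓝 0)) :
    Tendsto (fun B : ℕ => (B : ℝ) * (σ B ^ 2) ^ 2) atTop (𝓝 0) := by
  refine squeeze_zero (fun B => by positivity) (fun B => ?_) hCSI
  have : 0 ≤ (B : ℝ) * (σ B ^ 2) ^ 2 := by positivity
  rw [epsCSI]
  nlinarith [sq_nonneg (σ B)]

end Limit

/-! ### The limit of the error and its vanishing -/

lemma tendsto_mse0 {U W L : ℕ} (hL : 1 ≤ L) {δ : ℝ} (hδ : δ ^ 2 ≤ 1) {σ : ℕ → ℝ}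
    (hCSI : Tendsto (fun B : ℕ => epsCSI B (σ B)) atTop (𝓝 0))
    {Ω : ℕ → Type*} [∀ B, MeasurableSpace (Ω B)] {P : ∀ B, Measure (Ω B)}
    {h : ∀ B, Fin L → Fin B → Fin U → Ω B → ℂ} {e : ∀ B, Fin W → Fin B → Fin U → Ω B → ℂ}
    (hmodel : ∀ B, IsChannelModel (P B) (h B) (e B)) (near : Fin W → Fin W) (w : Fin W)
    (m n : Fin U) :
    Tendsto (fun B : ℕ => mse0 (P B) δ (σ B) (h B) (e B) near w m n) atTop
      (𝓝 (2 * δ ^ 2 *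
        (1 - fejer L (2 * Real.pi / (W : ℝ) * (((near w : ℕ) : ℝ) - ((w : ℕ) : ℝ)))))) := by
  simp_rw [fun B => (hmodel B).mse0_eq hL hδ (σ B) near w m n]
  by_cases hnw : near w = w
  · rw [hnw, sub_self, mul_zero, fejer_zero, sub_self, mul_zero]
    refine tendsto_const_nhds.congr fun B => ?_
    ring
  · have h0 : Tendsto (fun B : ℕ => (B : ℝ) * (0 : ℝ) ^ 2) atTop (𝓝 0) := by simp
    have h1 := tendsto_noisyCorrEnergy δ (tendsto_sq_of_epsCSI hCSI)
      (tendsto_mul_sq_sq_of_epsCSI hCSI)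
    have h2 := tendsto_noisyCorrEnergy δ (s := fun _ => 0) tendsto_const_nhds h0
    have h3 := (h1.const_mul 2).sub (h2.const_mul (2 * ‖phaseCorr L w (near w)‖ ^ 2))
    rw [normSq_phaseCorr hL] at h3
    refine (h3.congr fun B => ?_).trans (le_of_eq (congrArg 𝓝 (by ring)))
    rw [covEnergy_self hL, covEnergy_self hL, covEnergy_comm,
      covEnergy_of_ne δ (σ B) (Ne.symm hnw), normSq_phaseCorr hL]
    ring

theorem corollary1 (U W L : ℕ) (hL : 1 ≤ L) (hLW : L ≤ W)
    -- correlation parameter and channel-estimation error levels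
    (δ : ℝ) (hδ : δ ^ 2 ≤ 1) (σ : ℕ → ℝ) (hσ : ∀ B, 0 ≤ σ B)
    (hCSI : Tendsto (fun B : ℕ => epsCSI B (σ B)) atTop (𝓝 0))
    -- for every number of antennas, a realization of the channel model
    {Ω : ℕ → Type*} [∀ B, MeasurableSpace (Ω B)]
    (P : ∀ B, Measure (Ω B)) [∀ B, IsProbabilityMeasure (P B)]
    (h : ∀ B, Fin L → Fin B → Fin U → Ω B → ℂ) (e : ∀ B, Fin W → Fin B → Fin U → Ω B → ℂ)
    (hmodel : ∀ B, IsChannelModel (P B) (h B) (e B))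
    -- active subcarriers, base points, choice of a nearest base point
    (active base : Finset (Fin W)) (hbase : base ⊆ active)
    (near : Fin W → Fin W) (hnear : ∀ w ∈ active, IsNearestBasePoint base w (near w)) :
    -- the MSE is a genuine (finite) expectation
    (∀ B, ∀ w ∈ active, ∀ m n : Fin U,
      Integrable (sqError0 δ (σ B) (h B) (e B) near w m n) (P B)) ∧
    -- the large-antenna limit
    (∀ w ∈ active, ∀ m n : Fin U,
      Tendsto (fun B : ℕ => mse0 (P B) δ (σ B) (h B) (e B) near w m n) atTop
        (𝓝 (2 * δ ^ 2 *
          (1 - fejer L (2 * Real.pi / (W : ℝ) * (((near w : ℕ) : ℝ) - ((w : ℕ) : ℝ))))))) ∧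
    -- on each interpolated subcarrier it vanishes iff the antennas are uncorrelated
    (2 ≤ L → ∀ w ∈ active \ base, ∀ m n : Fin U,
      (Tendsto (fun B : ℕ => mse0 (P B) δ (σ B) (h B) (e B) near w m n) atTop (𝓝 0) ↔ δ = 0)) ∧
    -- it vanishes across all subcarriers iff the antennas are uncorrelated
    (2 ≤ L → 1 ≤ U → (active \ base).Nonempty →
      ((∀ w ∈ active, ∀ m n : Fin U,
        Tendsto (fun B : ℕ => mse0 (P B) δ (σ B) (h B) (e B) near w m n) atTop (𝓝 0)) ↔ δ = 0)) := by
  have hlim := fun w m n => tendsto_mse0 hL hδ hCSI hmodel near w m n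
  have hiff : 2 ≤ L → ∀ w ∈ active \ base, ∀ m n : Fin U,
      (Tendsto (fun B : ℕ => mse0 (P B) δ (σ B) (h B) (e B) near w m n) atTop (𝓝 0) ↔ δ = 0) := by
    intro hL2 w hw m n
    rw [Finset.mem_sdiff] at hw
    -- The nearest base point lies in `base` and w does not. The factor 1 - f_L is therefore
    -- positive, and a zero limit forces δ² = 0.
    have hne : near w ≠ w := fun heq => hw.2 (heq ▸ (hnear w hw.1).1)
    have hlt := fejer_lt_one hL2 (cos_phase_ne_one hne)
    refine ⟨fun h0 => ?_, fun h0 => ?_⟩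
    · have h1 := tendsto_nhds_unique (hlim w m n) h0
      rcases mul_eq_zero.mp h1 with h2 | h2
      · simpa using h2
      · linarith
    · simpa [h0] using hlim w m n
  refine ⟨fun B w _ m n => (hmodel B).integrable_sqError0 δ (σ B) near w m n,
    fun w _ m n => hlim w m n, hiff, fun hL2 hU hne => ⟨fun h0 => ?_, fun h0 w _ m n => ?_⟩⟩
  · obtain ⟨w, hw⟩ := hne
    exact (hiff hL2 w hw ⟨0, hU⟩ ⟨0, hU⟩).mp (h0 w (Finset.mem_sdiff.mp hw).1 _ _)
  · simpa [h0] using hlim w m n
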